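/- Let $N>1$ be an integer, $p\ge 2$, $s\in(0,1)$ with $ps<N$, and let $\Omega\subset\mathbb R^N$ be a bounded domain with $C^{1,1}$ boundary; $\Omega^c=\mathbb R^N\setminus\Omega$, and inequalities between functions are meant almost everywhere. For open $U\subseteq\mathbb R^N$ let $W^{s,p}(U)$ be the set of $u\in L^p(U)$ with $\iint_{U\times U}\frac{|u(x)-u(y)|^p}{|x-y|^{N+ps}}\,dx\,dy<\infty$. Let $W^{s,p}_0(\Omega)=\{u\in W^{s,p}(\mathbb R^N): u=0 \text{ in } \Omega^c\}$, and let $\widetilde W^{s,p}(\Omega)$ be the set of $u\in L^p_{\rm loc}(\mathbb R^N)$ such that $u\in W^{s,p}(U)$ for some open $U\supset\overline\Omega$ and $\int_{\mathbb R^N}\frac{|u(x)|^{p-1}}{(1+|x|)^{N+ps}}\,dx<\infty$. For $u\in\widetilde W^{s,p}(\Omega)$ and $v\in W^{s,p}_0(\Omega)$ put $$\langle(-\Delta)_p^s u,v\rangle=\iint_{\mathbb R^N\times\mathbb R^N}\frac{|u(x)-u(y)|^{p-2}(u(x)-u(y))(v(x)-v(y))}{|x-y|^{N+ps}}\,dx\,dy.$$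 Let $f:\Omega\times\mathbb R\to\mathbb R$ be a Carathéodory function such that (hypothesis $\mathbf H_0$) for some $c_0>0$ and $q\in\bigl(p,\tfrac{Np}{N-ps}\bigr)$, for a.e. $x\in\Omega$ and all $t\in\mathbb R$, $|f(x,t)|\le c_0(1+|t|^{q-1})$. A function $u\in\widetilde W^{s,p}(\Omega)$ is a supersolution of the problem $$(-\Delta)_p^s u=f(x,u)\ \text{ in }\Omega,\qquad u=0\ \text{ in }\Omega^c$$ if $u\ge0$ in $\Omega^c$ and $\langle(-\Delta)_p^s u,v\rangle\ge\int_\Omega f(x,u)v\,dx$ for all $v\in W^{s,p}_0(\Omega)$ with $v\ge0$; it is a subsolution if $u\le0$ in $\Omega^c$ and $\langle(-\Delta)_p^s u,v\rangle\le\int_\Omega f(x,u)v\,dx$ for all such $v$. Let $u_1,u_2\in\widetilde W^{s,p}(\Omega)$. (i) If $u_1,u_2$ are supersolutions of the problem, then so is $\min\{u_1,u_2\}$. (ii) If $u_1,u_2$ are subsolutions of the problem, then so is $\max\{u_1,u_2\}$. -/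

import Mathlib

open MeasureTheory Set

noncomputable section

/-- `ℝ^N` with its Euclidean norm. -/
abbrev RN (N : ℕ) : Type := EuclideanSpace ℝ (Fin N)

/-- `Ω` has a `C^{1,1}` boundary: near each boundary point, in suitable orthonormal coordinates
(the axis `ν` and the hyperplane orthogonal to it), `Ω` is the strict epigraph of a `C^1` function
with Lipschitz gradient. -/
def HasC11Boundary {N : ℕ} (Ω : Set (RN N)) : Prop :=
  ∀ x₀ ∈ frontier Ω, ∃ r > 0, ∃ ν : RN N, ‖ν‖ = 1 ∧
    ∃ γ : (Submodule.span ℝ {ν})ᗮ → ℝ,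
      ContDiff ℝ 1 γ ∧ (∃ K : NNReal, LipschitzWith K (fderiv ℝ γ)) ∧
      Ω ∩ Metric.ball x₀ r =
        {x | x ∈ Metric.ball x₀ r ∧
          γ ((Submodule.span ℝ {ν})ᗮ.orthogonalProjectionOnto x) < inner ℝ ν x}

/-- Bounded domains (nonempty connected open sets) with `C^{1,1}` boundary. -/
structure IsBoundedC11Domain {N : ℕ} (Ω : Set (RN N)) : Prop where
  isOpen : IsOpen Ω
  isConnected : IsConnected Ω
  isBounded : Bornology.IsBounded Ω
  boundary : HasC11Boundary Ω

/-- The Gagliardo energy `∬_{U×U} |u(x)-u(y)|^p / |x-y|^{N+ps} dx dy`, with values in `[0,∞]`. -/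
def gagliardo {N : ℕ} (s p : ℝ) (U : Set (RN N)) (u : RN N → ℝ) : ENNReal :=
  ∫⁻ z : RN N × RN N,
    ENNReal.ofReal (|u z.1 - u z.2| ^ p / ‖z.1 - z.2‖ ^ ((N : ℝ) + p * s))
    ∂((volume.restrict U).prod (volume.restrict U))

/-- `u ∈ W^{s,p}(U)`. -/
def MemW {N : ℕ} (s p : ℝ) (U : Set (RN N)) (u : RN N → ℝ) : Prop :=
  MemLp u (ENNReal.ofReal p) (volume.restrict U) ∧ gagliardo s p U u < ⊤

/-- `u ∈ W^{s,p}_0(Ω)`: `u ∈ W^{s,p}(ℝ^N)` and `u = 0` a.e. in the complement of `Ω`. -/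
def MemW0 {N : ℕ} (s p : ℝ) (Ω : Set (RN N)) (u : RN N → ℝ) : Prop :=
  MemW s p univ u ∧ ∀ᵐ x ∂(volume.restrict Ωᶜ), u x = 0

/-- `u ∈ W̃^{s,p}(Ω)`: `u ∈ L^p_loc(ℝ^N)`, `u ∈ W^{s,p}(U)` for some open `U` containing the
closure of `Ω`, and `∫ |u|^{p-1} / (1+|x|)^{N+ps} dx < ∞`. -/
def MemWTilde {N : ℕ} (s p : ℝ) (Ω : Set (RN N)) (u : RN N → ℝ) : Prop :=
  (∀ K : Set (RN N), IsCompact K → MemLp u (ENNReal.ofReal p) (volume.restrict K)) ∧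
  (∃ U : Set (RN N), IsOpen U ∧ closure Ω ⊆ U ∧ MemW s p U u) ∧
  (∫⁻ x : RN N, ENNReal.ofReal (|u x| ^ (p - 1) / (1 + ‖x‖) ^ ((N : ℝ) + p * s))) < ⊤

/-- The pairing `⟨(-Δ)_p^s u, v⟩`. -/
def fracPLaplacian {N : ℕ} (s p : ℝ) (u v : RN N → ℝ) : ℝ :=
  ∫ z : RN N × RN N,
    |u z.1 - u z.2| ^ (p - 2) * (u z.1 - u z.2) * (v z.1 - v z.2)
      / ‖z.1 - z.2‖ ^ ((N : ℝ) + p * s)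

/-- `f : Ω × ℝ → ℝ` is a Carathéodory function (values of `f x` for `x ∉ Ω` are irrelevant). -/
def IsCaratheodory {N : ℕ} (Ω : Set (RN N)) (f : RN N → ℝ → ℝ) : Prop :=
  (∀ t : ℝ, AEMeasurable (fun x => f x t) (volume.restrict Ω)) ∧
  ∀ᵐ x ∂(volume.restrict Ω), Continuous (f x)

/-- Hypothesis `H₀`: `f` is Carathéodory with subcritical growth, `p < q < p_s^* = Np/(N-ps)`. -/
def HypH0 {N : ℕ} (s p : ℝ) (Ω : Set (RN N)) (f : RN N → ℝ → ℝ) : Prop :=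
  IsCaratheodory Ω f ∧
  ∃ c₀ q : ℝ, 0 < c₀ ∧ p < q ∧ q < (N : ℝ) * p / ((N : ℝ) - p * s) ∧
    ∀ᵐ x ∂(volume.restrict Ω), ∀ t : ℝ, |f x t| ≤ c₀ * (1 + |t| ^ (q - 1))

/-- `u` is a supersolution of `(-Δ)_p^s u = f(x,u)` in `Ω`, `u = 0` in `Ωᶜ`. -/
structure IsSupersolution {N : ℕ} (s p : ℝ) (Ω : Set (RN N)) (f : RN N → ℝ → ℝ)
    (u : RN N → ℝ) : Prop where
  mem : MemWTilde s p Ω u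
  nonneg_compl : ∀ᵐ x ∂(volume.restrict Ωᶜ), 0 ≤ u x
  ge : ∀ v : RN N → ℝ, MemW0 s p Ω v → (∀ᵐ x, 0 ≤ v x) →
    ∫ x in Ω, f x (u x) * v x ≤ fracPLaplacian s p u v

/-- `u` is a subsolution of `(-Δ)_p^s u = f(x,u)` in `Ω`, `u = 0` in `Ωᶜ`. -/
structure IsSubsolution {N : ℕ} (s p : ℝ) (Ω : Set (RN N)) (f : RN N → ℝ → ℝ)
    (u : RN N → ℝ) : Prop where
  mem : MemWTilde s p Ω u
  nonpos_compl : ∀ᵐ x ∂(volume.restrict Ωᶜ), u x ≤ 0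
  le : ∀ v : RN N → ℝ, MemW0 s p Ω v → (∀ᵐ x, 0 ≤ v x) →
    fracPLaplacian s p u v ≤ ∫ x in Ω, f x (u x) * v x

end

/-!
For supersolutions `u₁`, `u₂`, put `u = min u₁ u₂` and let `v ≥ 0` be a test function. Split
`v = (v - φₙ) + φₙ` with `φₙ = min v (n (u₁ - u₂)⁺)`, and test `u₁` with `v - φₙ` and `u₂` with
`φₙ`. Both are admissible, since `W^{s,p}` is stable under lattice operations and a function of
`W^{s,p}(U)` vanishing off `Ω ⋐ U` lies in `W^{s,p}_0(Ω)` (`MemW.memW0`). As `n → ∞`, `φₙ` tends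
to `v` where `u₂ < u₁` and to `0` elsewhere, so that the reaction terms converge to
`∫ f(x, u) v`. For the nonlocal terms, monotonicity of `t ↦ |t|^{p-2} t` gives two pointwise facts:
the sum of the two integrands is bounded above by an integrable function independent of `n`
(`signedPow_test_le`), although the increments of `φₙ` themselves grow with `n`; and its pointwise
limit is at most the integrand of `⟨(-Δ)_p^s u, v⟩` (`signedPow_limit_le`). Dominated convergence
for the maximum of the two integrands concludes. Truncating by a minimum, rather than
multiplying `v` by a cut-off of `u₁ - u₂`, keeps the test functions admissible for unbounded `v`, so
that no density of smooth functions is needed. Subsolutions follow by the reflection `u ↦ -u`.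

Two integrability facts support the argument. The pairing converges absolutely
(`MemWTilde.integrable_pairing`): on `U × U` by Young's inequality, and on `Ω × Uᶜ` because the
kernel is comparable to `(1 + |y|)^{-(N+ps)}` there. The reaction term is integrable because of a
subcritical Sobolev embedding (`MemW.lintegral_rpow_lt_top`), proved by bootstrapping: if
`u ∈ L^a`, comparing `u x` with the value at a well-chosen point of a ball of suitable radius
around `x` bounds `|u x|^b`, with `b = p + (ps/N) a`, by a multiple of
`1 + ∫ |u x - u y|^p / |x - y|^{N+ps} dy`. Iterating `a ↦ b` from `a = p` approaches the critical
exponent `Np/(N-ps)`.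
-/

/-! ### Elementary real inequalities -/

lemma Real.add_rpow_le_two_rpow_mul {a b r : ℝ} (ha : 0 ≤ a) (hb : 0 ≤ b) (hr : 0 ≤ r) :
    (a + b) ^ r ≤ 2 ^ r * (a ^ r + b ^ r) := by
  have h0 := Real.rpow_nonneg ha r
  have h1 := Real.rpow_nonneg hb r
  have h2 : (0 : ℝ) ≤ 2 ^ r := by positivity
  rcases le_total a b with h | h
  · calc (a + b) ^ r ≤ (2 * b) ^ r := Real.rpow_le_rpow (by positivity) (by linarith) hr
      _ = 2 ^ r * b ^ r := Real.mul_rpow (by norm_num) hb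
      _ ≤ _ := by gcongr; linarith
  · calc (a + b) ^ r ≤ (2 * a) ^ r := Real.rpow_le_rpow (by positivity) (by linarith) hr
      _ = 2 ^ r * a ^ r := Real.mul_rpow (by norm_num) ha
      _ ≤ _ := by gcongr; linarith

lemma Real.abs_sub_rpow_le {a b r : ℝ} (hr : 0 ≤ r) :
    |a - b| ^ r ≤ 2 ^ r * (|a| ^ r + |b| ^ r) :=
  (Real.rpow_le_rpow (abs_nonneg _) (abs_sub a b) hr).trans
    (Real.add_rpow_le_two_rpow_mul (abs_nonneg _) (abs_nonneg _) hr)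

lemma Real.rpow_le_rpow_add_rpow_of_le_max {a b c r : ℝ} (hr : 0 ≤ r) (ha : 0 ≤ a) (hb : 0 ≤ b)
    (hc : 0 ≤ c) (h : a ≤ max b c) : a ^ r ≤ b ^ r + c ^ r := by
  have h0 := Real.rpow_nonneg hb r
  have h1 := Real.rpow_nonneg hc r
  rcases le_max_iff.1 h with h | h
  · linarith [Real.rpow_le_rpow ha h hr]
  · linarith [Real.rpow_le_rpow ha h hr]

lemma Real.rpow_sub_one_mul_le {a b r : ℝ} (ha : 0 ≤ a) (hb : 0 ≤ b) (hr : 1 < r) :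
    a ^ (r - 1) * b ≤ a ^ r + b ^ r := by
  have hm : 0 ≤ max a b := ha.trans (le_max_left _ _)
  calc a ^ (r - 1) * b ≤ max a b ^ (r - 1) * max a b :=
        mul_le_mul (Real.rpow_le_rpow ha (le_max_left _ _) (by linarith)) (le_max_right _ _) hb
          (by positivity)
    _ = max a b ^ r := by
        rcases hm.eq_or_lt with h | h
        · rw [← h, Real.zero_rpow (by linarith : r ≠ 0), mul_zero]
        · rw [← Real.rpow_add_one h.ne']; congr 1; ring
    _ ≤ _ := Real.rpow_le_rpow_add_rpow_of_le_max (by linarith) hm ha hb le_rfl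

lemma Real.rpow_le_one_add_rpow {a r t : ℝ} (ha : 0 ≤ a) (hr : 0 ≤ r) (hrt : r ≤ t) :
    a ^ r ≤ 1 + a ^ t := by
  rcases le_total a 1 with h | h
  · linarith [Real.rpow_le_one ha h hr, Real.rpow_nonneg ha t]
  · linarith [Real.rpow_le_rpow_of_exponent_le h hrt]

/-- The odd power `t ↦ |t|^{p-2} t`, the nonlinearity of the fractional `p`-Laplacian. -/
noncomputable def signedPow (p t : ℝ) : ℝ := |t| ^ (p - 2) * t

lemma abs_signedPow {p : ℝ} (hp : 1 < p) (t : ℝ) : |signedPow p t| = |t| ^ (p - 1) := by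
  rcases eq_or_ne t 0 with rfl | h
  · simp [signedPow, Real.zero_rpow (by linarith : p - 1 ≠ 0)]
  · have ht : |t| ≠ 0 := abs_ne_zero.2 h
    rw [signedPow, abs_mul, abs_of_nonneg (Real.rpow_nonneg (abs_nonneg t) _),
      ← Real.rpow_add_one ht]
    congr 1; ring

lemma signedPow_neg (p t : ℝ) : signedPow p (-t) = -signedPow p t := by
  simp [signedPow]

lemma signedPow_monotone {p : ℝ} (hp : 1 < p) : Monotone (signedPow p) := by
  refine monotone_of_odd_of_monotoneOn_nonneg (signedPow_neg p) ?_
  have key : ∀ t : ℝ, 0 ≤ t → signedPow p t = t ^ (p - 1) := fun t ht => by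
    rw [← abs_of_nonneg (show 0 ≤ signedPow p t from mul_nonneg (by positivity) ht),
      abs_signedPow hp, abs_of_nonneg ht]
  intro a ha b hb hab
  rw [key a ha, key b hb]
  exact Real.rpow_le_rpow ha hab (by linarith)

/-! ### The lattice test functions -/

/-- The increment of `min v w` is controlled from the favourable side by the increment of `v`. -/
lemma neg_abs_sub_le_min_sub_min {v₁ v₂ w₁ w₂ : ℝ} (h : w₂ ≤ w₁) :
    -|v₁ - v₂| ≤ min v₁ w₁ - min v₂ w₂ := by
  have h1 : min v₁ w₂ ≤ min v₁ w₁ := min_le_min_left _ h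
  have h2 := abs_min_sub_min_le_max v₁ w₂ v₂ w₂
  rw [sub_self, abs_zero, max_eq_left (abs_nonneg _)] at h2
  linarith [(abs_le.1 h2).1]

/-- Monotonicity of `signedPow` makes the contribution of the increments of the cut-off part `w`
nonpositive, so that the bound does not depend on `k`. -/
lemma signedPow_test_le {p : ℝ} (hp : 1 < p) {a₁ a₂ b₁ b₂ v₁ v₂ k : ℝ} (hk : 0 ≤ k) :
    signedPow p (a₁ - a₂) * ((v₁ - min v₁ (k * max (a₁ - b₁) 0))
        - (v₂ - min v₂ (k * max (a₂ - b₂) 0)))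
      + signedPow p (b₁ - b₂) * (min v₁ (k * max (a₁ - b₁) 0) - min v₂ (k * max (a₂ - b₂) 0))
      ≤ (2 * |signedPow p (a₁ - a₂)| + |signedPow p (b₁ - b₂)|) * |v₁ - v₂| := by
  set A := signedPow p (a₁ - a₂) with hA
  set B := signedPow p (b₁ - b₂) with hB
  have hAv : A * (v₁ - v₂) ≤ |A| * |v₁ - v₂| := by
    rw [← abs_mul]; exact le_abs_self _
  have hAB : |B - A| ≤ |A| + |B| := by linarith [abs_sub B A]
  have key : (B - A) * (min v₁ (k * max (a₁ - b₁) 0) - min v₂ (k * max (a₂ - b₂) 0))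
      ≤ |B - A| * |v₁ - v₂| := by
    rcases le_total (a₂ - b₂) (a₁ - b₁) with h | h
    · have hBA : B ≤ A := signedPow_monotone hp (by linarith)
      have hw : k * max (a₂ - b₂) 0 ≤ k * max (a₁ - b₁) 0 :=
        mul_le_mul_of_nonneg_left (max_le_max_right _ h) hk
      have := neg_abs_sub_le_min_sub_min (v₁ := v₁) (v₂ := v₂) hw
      rw [abs_of_nonpos (sub_nonpos.2 hBA)]
      nlinarith
    · have hBA : A ≤ B := signedPow_monotone hp (by linarith)
      have hw : k * max (a₁ - b₁) 0 ≤ k * max (a₂ - b₂) 0 :=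
        mul_le_mul_of_nonneg_left (max_le_max_right _ h) hk
      have := neg_abs_sub_le_min_sub_min (v₁ := v₂) (v₂ := v₁) hw
      rw [abs_sub_comm v₂ v₁] at this
      rw [abs_of_nonneg (sub_nonneg.2 hBA)]
      nlinarith
  nlinarith [abs_nonneg (v₁ - v₂), mul_le_mul_of_nonneg_right hAB (abs_nonneg (v₁ - v₂))]

/-- In the limit the two tested nonlinearities are dominated by that of the minimum. -/
lemma signedPow_limit_le {p : ℝ} (hp : 1 < p) {a₁ a₂ b₁ b₂ v₁ v₂ : ℝ} (hv₁ : 0 ≤ v₁)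
    (hv₂ : 0 ≤ v₂) :
    signedPow p (a₁ - a₂) * ((v₁ - if 0 < a₁ - b₁ then v₁ else 0)
        - (v₂ - if 0 < a₂ - b₂ then v₂ else 0))
      + signedPow p (b₁ - b₂) * ((if 0 < a₁ - b₁ then v₁ else 0)
        - if 0 < a₂ - b₂ then v₂ else 0)
      ≤ signedPow p (min a₁ b₁ - min a₂ b₂) * (v₁ - v₂) := by
  have mono := signedPow_monotone hp
  by_cases h1 : 0 < a₁ - b₁ <;> by_cases h2 : 0 < a₂ - b₂
  · rw [min_eq_right (by linarith : b₁ ≤ a₁), min_eq_right (by linarith : b₂ ≤ a₂)]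
    simp [h1, h2]
  · rw [min_eq_right (by linarith : b₁ ≤ a₁), min_eq_left (by linarith : a₂ ≤ b₂)]
    simp only [h1, h2, if_true, if_false]
    nlinarith [mul_le_mul_of_nonneg_right (mono (by linarith : b₁ - b₂ ≤ b₁ - a₂)) hv₁,
      mul_le_mul_of_nonneg_right (mono (by linarith : b₁ - a₂ ≤ a₁ - a₂)) hv₂]
  · rw [min_eq_left (by linarith : a₁ ≤ b₁), min_eq_right (by linarith : b₂ ≤ a₂)]
    simp only [h1, h2, if_true, if_false]
    nlinarith [mul_le_mul_of_nonneg_right (mono (by linarith : a₁ - a₂ ≤ a₁ - b₂)) hv₁,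
      mul_le_mul_of_nonneg_right (mono (by linarith : a₁ - b₂ ≤ b₁ - b₂)) hv₂]
  · rw [min_eq_left (by linarith : a₁ ≤ b₁), min_eq_left (by linarith : a₂ ≤ b₂)]
    simp [h1, h2]

lemma eventually_min_nat_mul_eq {v d : ℝ} (hv : 0 ≤ v) :
    ∀ᶠ n : ℕ in Filter.atTop, min v (n * max d 0) = if 0 < d then v else 0 := by
  by_cases hd : 0 < d
  · obtain ⟨m, hm⟩ := exists_nat_gt (v / d)
    filter_upwards [Filter.eventually_ge_atTop m] with n hn
    have hmn : (m : ℝ) ≤ n := by exact_mod_cast hn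
    rw [if_pos hd, max_eq_left hd.le, min_eq_left]
    exact ((div_lt_iff₀ hd).1 hm).le.trans (mul_le_mul_of_nonneg_right hmn hd.le)
  · refine Filter.Eventually.of_forall fun n => ?_
    rw [if_neg hd, max_eq_right (not_lt.1 hd), mul_zero, min_eq_right hv]

/-! ### Measurability and integrability of powers -/

lemma memLp_ofReal_iff {α : Type*} [MeasurableSpace α] {μ : Measure α} {u : α → ℝ} {p : ℝ}
    (hp : 0 < p) :
    MemLp u (ENNReal.ofReal p) μ ↔
      AEStronglyMeasurable u μ ∧ ∫⁻ x, ENNReal.ofReal (|u x| ^ p) ∂μ < ⊤ := by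
  rw [MemLp, eLpNorm_lt_top_iff_lintegral_rpow_enorm_lt_top (by simpa using hp)
    ENNReal.ofReal_ne_top, ENNReal.toReal_ofReal hp.le]
  simp_rw [Real.enorm_eq_ofReal_abs, ENNReal.ofReal_rpow_of_nonneg (abs_nonneg _) hp.le]

/-- A Carathéodory function composed with a measurable function is measurable. -/
lemma IsCaratheodory.aemeasurable_comp {N : ℕ} {Ω : Set (RN N)} {f : RN N → ℝ → ℝ}
    (hf : IsCaratheodory Ω f) {u : RN N → ℝ} (hu : AEMeasurable u (volume.restrict Ω)) :
    AEMeasurable (fun x => f x (u x)) (volume.restrict Ω) := by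
  suffices hmk : ∀ g : RN N → ℝ, StronglyMeasurable g →
      AEMeasurable (fun x => f x (g x)) (volume.restrict Ω) by
    refine (hmk _ hu.measurable_mk.stronglyMeasurable).congr ?_
    filter_upwards [hu.ae_eq_mk] with x hx
    rw [hx]
  · intro g hsm
    refine aemeasurable_of_tendsto_metrizable_ae Filter.atTop
      (f := fun n x => f x (hsm.approx n x)) (fun n => ?_) ?_
    · -- A simple function takes countably many values, and `f · t` is measurable for each `t`.
      have hcov : (⋃ t : (hsm.approx n).range, (hsm.approx n) ⁻¹' {(t : ℝ)}) = univ := by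
        refine eq_univ_of_forall fun x => mem_iUnion.2 ⟨⟨hsm.approx n x, ?_⟩, rfl⟩
        exact SimpleFunc.mem_range_self _ _
      rw [← Measure.restrict_univ (μ := volume.restrict Ω), ← hcov, aemeasurable_iUnion_iff]
      intro t
      refine ((hf.1 t).restrict).congr ?_
      refine (ae_restrict_iff' ((hsm.approx n).measurableSet_fiber _)).2
        (Filter.Eventually.of_forall fun x hx => ?_)
      simp only [mem_preimage, mem_singleton_iff] at hx
      simp [hx]
    · filter_upwards [hf.2] with x hx
      exact (hx.tendsto _).comp (hsm.tendsto_approx x)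

/-! ### Double integrals with one variable in `Ω` -/

section Splitting

variable {N : ℕ}

lemma exists_one_add_norm_le_mul_norm_sub {Ω U : Set (RN N)} (hb : Bornology.IsBounded Ω)
    (hU : IsOpen U) (hΩU : closure Ω ⊆ U) :
    ∃ C : ℝ, 0 < C ∧ ∀ x ∈ Ω, ∀ y ∈ Uᶜ, 1 + ‖y‖ ≤ C * ‖x - y‖ := by
  obtain ⟨δ, hδ, hδU⟩ := hb.isCompact_closure.exists_thickening_subset_open hU hΩU
  obtain ⟨R, hR, hΩR⟩ := hb.exists_pos_norm_le
  refine ⟨(1 + R) / δ + 1, by positivity, fun x hx y hy => ?_⟩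
  have hxy : δ ≤ ‖x - y‖ := by
    by_contra! h
    refine hy (hδU (Metric.mem_thickening_iff.2 ⟨x, subset_closure hx, ?_⟩))
    rwa [dist_comm, dist_eq_norm]
  have h1 : ‖y‖ ≤ ‖x‖ + ‖x - y‖ := by
    have := norm_sub_le x (x - y)
    rwa [sub_sub_cancel] at this
  have h2 : 1 + R ≤ (1 + R) / δ * ‖x - y‖ := by
    rw [div_mul_eq_mul_div, le_div_iff₀ hδ]
    exact mul_le_mul_of_nonneg_left hxy (by positivity)
  linarith [hΩR x hx]

lemma lintegral_prod_mul_div_lt_top {Ω U : Set (RN N)} (hΩ : IsOpen Ω)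
    (hb : Bornology.IsBounded Ω) (hU : IsOpen U) (hΩU : closure Ω ⊆ U) {m : ℝ} (hm : 0 ≤ m)
    {a h : RN N → ℝ} (ha0 : ∀ x, 0 ≤ a x) (hh0 : ∀ x, 0 ≤ h x)
    (ha : AEMeasurable a (volume.restrict Ω)) (hh : AEMeasurable h)
    (hai : ∫⁻ x in Ω, ENNReal.ofReal (a x) < ⊤)
    (hhi : ∫⁻ y, ENNReal.ofReal (h y / (1 + ‖y‖) ^ m) < ⊤) :
    ∫⁻ z : RN N × RN N, ENNReal.ofReal (a z.1 * h z.2 / ‖z.1 - z.2‖ ^ m)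
      ∂((volume.restrict Ω).prod (volume.restrict Uᶜ)) < ⊤ := by
  obtain ⟨C, hC, hCb⟩ := exists_one_add_norm_le_mul_norm_sub hb hU hΩU
  have hms : MeasurableSet (Ω ×ˢ Uᶜ) := hΩ.measurableSet.prod hU.measurableSet.compl
  have hh' : AEMeasurable (fun y => h y / (1 + ‖y‖) ^ m) :=
    hh.div (((measurable_const.add measurable_norm).pow_const m).aemeasurable)
  calc ∫⁻ z : RN N × RN N, ENNReal.ofReal (a z.1 * h z.2 / ‖z.1 - z.2‖ ^ m)
        ∂((volume.restrict Ω).prod (volume.restrict Uᶜ))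
      ≤ ∫⁻ z : RN N × RN N, ENNReal.ofReal (C ^ m) *
          (ENNReal.ofReal (a z.1) * ENNReal.ofReal (h z.2 / (1 + ‖z.2‖) ^ m))
        ∂((volume.restrict Ω).prod (volume.restrict Uᶜ)) := by
        rw [Measure.prod_restrict]
        refine setLIntegral_mono' hms fun z hz => ?_
        rw [← ENNReal.ofReal_mul (ha0 _), ← ENNReal.ofReal_mul (by positivity)]
        refine ENNReal.ofReal_le_ofReal ?_
        have h1 := hCb z.1 hz.1 z.2 hz.2
        have h0 : 0 < 1 + ‖z.2‖ := by positivity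
        have hpos : 0 < ‖z.1 - z.2‖ := by
          by_contra! hle
          nlinarith [mul_nonneg hC.le (sub_nonneg.2 hle)]
        have h2 : (1 + ‖z.2‖) ^ m ≤ C ^ m * ‖z.1 - z.2‖ ^ m := by
          rw [← Real.mul_rpow hC.le hpos.le]
          exact Real.rpow_le_rpow h0.le h1 hm
        have hk : 0 < (1 + ‖z.2‖) ^ m := Real.rpow_pos_of_pos h0 _
        have hk' : 0 < ‖z.1 - z.2‖ ^ m := Real.rpow_pos_of_pos hpos _
        have hah := mul_nonneg (ha0 z.1) (hh0 z.2)
        rw [div_le_iff₀ hk']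
        calc a z.1 * h z.2 = a z.1 * h z.2 / (1 + ‖z.2‖) ^ m * (1 + ‖z.2‖) ^ m := by
              field_simp
          _ ≤ a z.1 * h z.2 / (1 + ‖z.2‖) ^ m * (C ^ m * ‖z.1 - z.2‖ ^ m) := by gcongr
          _ = _ := by ring
    _ = ENNReal.ofReal (C ^ m) * ((∫⁻ x in Ω, ENNReal.ofReal (a x)) *
          ∫⁻ y in Uᶜ, ENNReal.ofReal (h y / (1 + ‖y‖) ^ m)) := by
        rw [lintegral_const_mul' _ _ ENNReal.ofReal_ne_top,
          lintegral_prod_mul ha.ennreal_ofReal hh'.restrict.ennreal_ofReal]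
    _ < ⊤ := ENNReal.mul_lt_top ENNReal.ofReal_lt_top (ENNReal.mul_lt_top hai
        ((setLIntegral_le_lintegral _ _).trans_lt hhi))

/-- A symmetric double integral whose integrand vanishes off `Ω` in both variables reduces to the
integrals over `U × U` and `Ω × Uᶜ`. -/
lemma lintegral_prod_lt_top_of_symm {Ω U : Set (RN N)} {E : RN N × RN N → ENNReal}
    (hsymm : ∀ z, E z.swap = E z)
    (h0 : ∫⁻ z, E z ∂((volume.restrict Ωᶜ).prod (volume.restrict Ωᶜ)) = 0)
    (hUU : ∫⁻ z, E z ∂((volume.restrict U).prod (volume.restrict U)) < ⊤)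
    (hΩU : Ω ⊆ U)
    (hcross : ∫⁻ z, E z ∂((volume.restrict Ω).prod (volume.restrict Uᶜ)) < ⊤) :
    ∫⁻ z, E z < ⊤ := by
  have hswap : ∫⁻ z, E z ∂((volume.restrict Uᶜ).prod (volume.restrict Ω)) < ⊤ := by
    rw [← lintegral_prod_swap]
    simpa only [hsymm] using hcross
  rw [Measure.prod_restrict] at h0 hUU hcross hswap
  have hcov : (univ : Set (RN N × RN N)) ⊆
      (U ×ˢ U ∪ Ω ×ˢ Uᶜ) ∪ (Uᶜ ×ˢ Ω ∪ Ωᶜ ×ˢ Ωᶜ) := by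
    rintro ⟨x, y⟩ -
    have hx := @hΩU x
    have hy := @hΩU y
    simp only [mem_union, mem_prod, mem_compl_iff]
    tauto
  rw [← setLIntegral_univ]
  refine (lintegral_mono_set hcov).trans_lt ((lintegral_union_le _ _ _).trans_lt
    (ENNReal.add_lt_top.2 ⟨(lintegral_union_le _ _ _).trans_lt (ENNReal.add_lt_top.2 ⟨hUU, hcross⟩),
      (lintegral_union_le _ _ _).trans_lt (ENNReal.add_lt_top.2 ⟨hswap, ?_⟩)⟩))
  exact h0.trans_lt ENNReal.zero_lt_top

lemma ae_prod_fst {μ ν : Measure (RN N)} {P : RN N → Prop} (h : ∀ᵐ x ∂μ, P x) :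
    ∀ᵐ z ∂(μ.prod ν), P z.1 :=
  Measure.quasiMeasurePreserving_fst.ae h

lemma ae_prod_snd {μ ν : Measure (RN N)} [SFinite ν] {P : RN N → Prop} (h : ∀ᵐ x ∂ν, P x) :
    ∀ᵐ z ∂(μ.prod ν), P z.2 :=
  Measure.quasiMeasurePreserving_snd.ae h

lemma lintegral_one_div_one_add_norm_rpow_lt_top {m : ℝ} (hm : (N : ℝ) < m) :
    ∫⁻ y : RN N, ENNReal.ofReal (1 / (1 + ‖y‖) ^ m) < ⊤ := by
  have h : Integrable (fun y : RN N => (1 + ‖y‖) ^ (-m)) :=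
    integrable_one_add_norm (by simpa using hm)
  have h2 := (hasFiniteIntegral_iff_ofReal
    (Filter.Eventually.of_forall fun y => by positivity)).1 h.hasFiniteIntegral
  convert h2 using 4 with y
  rw [Real.rpow_neg (by positivity), one_div]

end Splitting

/-! ### The function spaces -/

section Spaces

variable {N : ℕ} {s p : ℝ} {Ω U : Set (RN N)} {u v : RN N → ℝ}

lemma aemeasurable_gagliardo_integrand {μ ν : Measure (RN N)} [SFinite μ] [SFinite ν]
    (hμ : AEMeasurable u μ) (hν : AEMeasurable u ν) (p m : ℝ) :
    AEMeasurable (fun z : RN N × RN N =>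
      ENNReal.ofReal (|u z.1 - u z.2| ^ p / ‖z.1 - z.2‖ ^ m)) (μ.prod ν) := by
  have h1 : AEMeasurable (fun z : RN N × RN N => |u z.1 - u z.2|) (μ.prod ν) :=
    (hμ.comp_fst.sub hν.comp_snd).abs
  exact ((h1.pow_const p).div
    ((measurable_fst.sub measurable_snd).norm.pow_const m).aemeasurable).ennreal_ofReal

lemma MemW.aemeasurable (h : MemW s p U u) : AEMeasurable u (volume.restrict U) :=
  h.1.aestronglyMeasurable.aemeasurable

lemma MemW.mono {V : Set (RN N)} (h : MemW s p U u) (hV : V ⊆ U) : MemW s p V u := by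
  refine ⟨h.1.mono_measure (Measure.restrict_mono hV le_rfl), lt_of_le_of_lt ?_ h.2⟩
  rw [gagliardo, gagliardo, Measure.prod_restrict, Measure.prod_restrict]
  exact lintegral_mono_set (prod_mono hV hV)

/-- A function built from `u₁`, `u₂` whose size and increments are bounded by the larger of the
sizes and increments of `u₁` and `u₂` is in `W^{s,p}(U)` when they are. -/
lemma MemW.of_abs_le_max (hp : 0 < p) {u₁ u₂ φ : RN N → ℝ}
    (h₁ : MemW s p U u₁) (h₂ : MemW s p U u₂) (hφ : AEStronglyMeasurable φ (volume.restrict U))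
    (hle : ∀ x, |φ x| ≤ max |u₁ x| |u₂ x|)
    (hsub : ∀ x y, |φ x - φ y| ≤ max |u₁ x - u₁ y| |u₂ x - u₂ y|) : MemW s p U φ := by
  have b₁ := ((memLp_ofReal_iff hp).1 h₁.1).2
  have b₂ := ((memLp_ofReal_iff hp).1 h₂.1).2
  refine ⟨(memLp_ofReal_iff hp).2 ⟨hφ, ?_⟩, ?_⟩
  · calc ∫⁻ x in U, ENNReal.ofReal (|φ x| ^ p)
        ≤ ∫⁻ x in U, (ENNReal.ofReal (|u₁ x| ^ p) + ENNReal.ofReal (|u₂ x| ^ p)) := by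
          refine lintegral_mono fun x => ?_
          rw [← ENNReal.ofReal_add (by positivity) (by positivity)]
          exact ENNReal.ofReal_le_ofReal (Real.rpow_le_rpow_add_rpow_of_le_max hp.le
            (abs_nonneg _) (abs_nonneg _) (abs_nonneg _) (hle x))
      _ = _ := lintegral_add_left' (h₁.aemeasurable.abs.pow_const p).ennreal_ofReal _
      _ < ⊤ := ENNReal.add_lt_top.2 ⟨b₁, b₂⟩
  · calc gagliardo s p U φ
        ≤ ∫⁻ z : RN N × RN N,
            (ENNReal.ofReal (|u₁ z.1 - u₁ z.2| ^ p / ‖z.1 - z.2‖ ^ ((N : ℝ) + p * s))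
            + ENNReal.ofReal (|u₂ z.1 - u₂ z.2| ^ p / ‖z.1 - z.2‖ ^ ((N : ℝ) + p * s)))
            ∂((volume.restrict U).prod (volume.restrict U)) := by
          refine lintegral_mono fun z => ?_
          rw [← ENNReal.ofReal_add (by positivity) (by positivity), ← add_div]
          refine ENNReal.ofReal_le_ofReal ?_
          gcongr
          exact Real.rpow_le_rpow_add_rpow_of_le_max hp.le
            (abs_nonneg _) (abs_nonneg _) (abs_nonneg _) (hsub _ _)
      _ = gagliardo s p U u₁ + gagliardo s p U u₂ :=
          lintegral_add_left'
            (aemeasurable_gagliardo_integrand h₁.aemeasurable h₁.aemeasurable _ _) _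
      _ < ⊤ := ENNReal.add_lt_top.2 ⟨h₁.2, h₂.2⟩

lemma MemW.const_mul (h : MemW s p U u) (c : ℝ) :
    MemW s p U (fun x => c * u x) := by
  refine ⟨h.1.const_mul c, ?_⟩
  have : gagliardo s p U (fun x => c * u x) = ENNReal.ofReal (|c| ^ p) * gagliardo s p U u := by
    rw [gagliardo, gagliardo, ← lintegral_const_mul' _ _ ENNReal.ofReal_ne_top]
    refine lintegral_congr fun z => ?_
    rw [← ENNReal.ofReal_mul (by positivity), ← mul_sub, abs_mul,
      Real.mul_rpow (abs_nonneg _) (abs_nonneg _), mul_div_assoc]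
  rw [this]
  exact ENNReal.mul_lt_top ENNReal.ofReal_lt_top h.2

lemma MemW.sub (hp : 0 < p) {u₁ u₂ : RN N → ℝ} (h₁ : MemW s p U u₁) (h₂ : MemW s p U u₂) :
    MemW s p U (fun x => u₁ x - u₂ x) := by
  -- `|a - b| ≤ max |2a| |2b|` reduces subtraction to the lattice bound.
  have key : ∀ a b : ℝ, |a - b| ≤ max |2 * a| |2 * b| := fun a b => by
    rw [abs_mul, abs_mul, abs_two]
    have := abs_sub a b
    rcases le_total |a| |b| with h | h
    · exact le_max_of_le_right (by linarith)
    · exact le_max_of_le_left (by linarith)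
  refine MemW.of_abs_le_max hp (h₁.const_mul 2) (h₂.const_mul 2)
    (h₁.1.aestronglyMeasurable.sub h₂.1.aestronglyMeasurable) (fun x => key _ _) fun x y => ?_
  rw [sub_sub_sub_comm, ← mul_sub, ← mul_sub]
  exact key _ _

lemma MemW0.aestronglyMeasurable (h : MemW0 s p Ω v) : AEStronglyMeasurable v := by
  simpa using h.1.1.aestronglyMeasurable

lemma MemW0.memW (h : MemW0 s p Ω v) (U : Set (RN N)) : MemW s p U v :=
  h.1.mono (subset_univ U)

lemma MemWTilde.aestronglyMeasurable (h : MemWTilde s p Ω u) : AEStronglyMeasurable u := by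
  have hcov : (⋃ n : ℕ, Metric.closedBall (0 : RN N) n) = univ := Metric.iUnion_closedBall_nat _
  rw [← Measure.restrict_univ (μ := volume), ← hcov, aestronglyMeasurable_iUnion_iff]
  exact fun n => (h.1 _ (isCompact_closedBall _ _)).aestronglyMeasurable

/-- A function of `W^{s,p}(U)` vanishing off `Ω ⋐ U` belongs to `W^{s,p}_0(Ω)`. -/
lemma MemW.memW0 (hp : 0 < p) (hs : 0 < s) (hΩ : IsOpen Ω) (hb : Bornology.IsBounded Ω)
    (hU : IsOpen U) (hΩU : closure Ω ⊆ U) (hu : AEStronglyMeasurable u) (h : MemW s p U u)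
    (h0 : ∀ᵐ x ∂(volume.restrict Ωᶜ), u x = 0) : MemW0 s p Ω u := by
  have hsub : Ω ⊆ U := subset_closure.trans hΩU
  have hUc : ∀ᵐ x ∂(volume.restrict Uᶜ), u x = 0 :=
    ae_restrict_of_ae_restrict_of_subset (compl_subset_compl.2 hsub) h0
  have hΩfin : ∫⁻ x in Ω, ENNReal.ofReal (|u x| ^ p) < ⊤ :=
    (lintegral_mono_set hsub).trans_lt ((memLp_ofReal_iff hp).1 h.1).2
  refine ⟨⟨?_, ?_⟩, h0⟩
  · rw [Measure.restrict_univ, memLp_ofReal_iff hp]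
    refine ⟨hu, ?_⟩
    rw [← lintegral_add_compl _ hΩ.measurableSet]
    have : ∫⁻ x in Ωᶜ, ENNReal.ofReal (|u x| ^ p) = 0 := by
      rw [lintegral_eq_zero_iff' (hu.aemeasurable.abs.pow_const p).ennreal_ofReal.restrict]
      filter_upwards [h0] with x hx
      simp [hx, Real.zero_rpow hp.ne']
    rwa [this, add_zero]
  · rw [gagliardo, Measure.restrict_univ]
    refine lintegral_prod_lt_top_of_symm (U := U) (Ω := Ω) (fun z => ?_) ?_ h.2 hsub ?_
    · rw [Prod.fst_swap, Prod.snd_swap, abs_sub_comm, norm_sub_rev]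
    · rw [lintegral_eq_zero_iff' (aemeasurable_gagliardo_integrand
        hu.aemeasurable.restrict hu.aemeasurable.restrict _ _)]
      filter_upwards [ae_prod_fst h0, ae_prod_snd h0] with z h1 h2
      simp [h1, h2, Real.zero_rpow hp.ne']
    · have := lintegral_prod_mul_div_lt_top hΩ hb hU hΩU (m := N + p * s) (by positivity)
        (a := fun x => |u x| ^ p) (h := fun _ => 1) (fun x => by positivity) (fun x => by positivity)
        (hu.aemeasurable.abs.pow_const p).restrict aemeasurable_const hΩfin
        (lintegral_one_div_one_add_norm_rpow_lt_top (lt_add_of_pos_right _ (mul_pos hp hs)))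
      refine lt_of_eq_of_lt (lintegral_congr_ae ?_) this
      filter_upwards [ae_prod_snd hUc] with z h2
      simp [h2]

/-- The double integral defining `⟨(-Δ)_p^s u, v⟩` converges absolutely. -/
lemma MemWTilde.integrable_pairing (hp : 2 ≤ p) (hs : 0 < s) (hΩ : IsOpen Ω)
    (hb : Bornology.IsBounded Ω) (hu : MemWTilde s p Ω u) (hv : MemW0 s p Ω v) :
    Integrable (fun z : RN N × RN N => signedPow p (u z.1 - u z.2) * (v z.1 - v z.2)
      / ‖z.1 - z.2‖ ^ ((N : ℝ) + p * s)) := by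
  have hp0 : 0 < p := by linarith
  have hp1 : 1 < p := by linarith
  have hum := hu.aestronglyMeasurable.aemeasurable
  have hvm := hv.aestronglyMeasurable.aemeasurable
  obtain ⟨-, ⟨U, hU, hΩU, hWU⟩, htail⟩ := hu
  have hsub : Ω ⊆ U := subset_closure.trans hΩU
  have h0 := hv.2
  have hUc : ∀ᵐ x ∂(volume.restrict Uᶜ), v x = 0 :=
    ae_restrict_of_ae_restrict_of_subset (compl_subset_compl.2 hsub) h0
  have hup : ∫⁻ x in Ω, ENNReal.ofReal (|u x| ^ p) < ⊤ :=
    (lintegral_mono_set hsub).trans_lt ((memLp_ofReal_iff hp0).1 hWU.1).2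
  have hvp : ∫⁻ x in Ω, ENNReal.ofReal (|v x| ^ p) < ⊤ :=
    ((memLp_ofReal_iff hp0).1 (hv.memW Ω).1).2
  have hum' : AEMeasurable (fun z : RN N × RN N => u z.1 - u z.2) :=
    hum.comp_fst.sub hum.comp_snd
  have hvm' : AEMeasurable (fun z : RN N × RN N => v z.1 - v z.2) :=
    hvm.comp_fst.sub hvm.comp_snd
  have hkm : AEMeasurable (fun z : RN N × RN N => ‖z.1 - z.2‖ ^ ((N : ℝ) + p * s)) :=
    ((measurable_fst.sub measurable_snd).norm.pow_const _).aemeasurable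
  refine ⟨((((hum'.abs.pow_const _).mul hum').mul hvm').div hkm).aestronglyMeasurable, ?_⟩
  rw [hasFiniteIntegral_iff_norm]
  have hnorm : ∀ z : RN N × RN N, ‖signedPow p (u z.1 - u z.2) * (v z.1 - v z.2)
      / ‖z.1 - z.2‖ ^ ((N : ℝ) + p * s)‖ = |u z.1 - u z.2| ^ (p - 1) * |v z.1 - v z.2|
      / ‖z.1 - z.2‖ ^ ((N : ℝ) + p * s) := fun z => by
    rw [Real.norm_eq_abs, abs_div, abs_mul, abs_signedPow hp1,
      abs_of_nonneg (Real.rpow_nonneg (norm_nonneg _) _)]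
  simp_rw [hnorm]
  refine lintegral_prod_lt_top_of_symm (U := U) (Ω := Ω) (fun z => ?_) ?_ ?_ hsub ?_
  · rw [Prod.fst_swap, Prod.snd_swap, abs_sub_comm, norm_sub_rev, abs_sub_comm (v z.2)]
  · refine (lintegral_congr_ae ?_).trans lintegral_zero
    filter_upwards [ae_prod_fst h0, ae_prod_snd h0] with z h1 h2
    simp [h1, h2]
  · calc _ ≤ ∫⁻ z : RN N × RN N,
            (ENNReal.ofReal (|u z.1 - u z.2| ^ p / ‖z.1 - z.2‖ ^ ((N : ℝ) + p * s))
            + ENNReal.ofReal (|v z.1 - v z.2| ^ p / ‖z.1 - z.2‖ ^ ((N : ℝ) + p * s)))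
            ∂((volume.restrict U).prod (volume.restrict U)) := by
          refine lintegral_mono fun z => ?_
          rw [← ENNReal.ofReal_add (by positivity) (by positivity), ← add_div]
          refine ENNReal.ofReal_le_ofReal ?_
          gcongr
          exact Real.rpow_sub_one_mul_le (abs_nonneg _) (abs_nonneg _) hp1
      _ = gagliardo s p U u + gagliardo s p U v :=
          lintegral_add_left' (aemeasurable_gagliardo_integrand hum.restrict hum.restrict _ _) _
      _ < ⊤ := ENNReal.add_lt_top.2 ⟨hWU.2, (hv.memW U).2⟩
  · -- Off the diagonal block, `|u x - u y|^{p-1} |v x|` splits into two products.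
    have hΩfin : ∫⁻ x in Ω, ENNReal.ofReal 1 < ⊤ := by
      simpa using hb.measure_lt_top
    have t1 := lintegral_prod_mul_div_lt_top hΩ hb hU hΩU (m := N + p * s) (by positivity)
      (a := fun x => 2 ^ (p - 1) * (|u x| ^ p + |v x| ^ p)) (h := fun _ => 1)
      (fun x => by positivity) (fun x => by positivity)
      (((hum.abs.pow_const p).add (hvm.abs.pow_const p)).const_mul _).restrict aemeasurable_const
      (by
        simp_rw [ENNReal.ofReal_mul (by positivity : (0 : ℝ) ≤ 2 ^ (p - 1))]
        rw [lintegral_const_mul' _ _ ENNReal.ofReal_ne_top]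
        refine ENNReal.mul_lt_top ENNReal.ofReal_lt_top ?_
        refine lt_of_le_of_lt (lintegral_mono fun x => ENNReal.ofReal_add_le) ?_
        rw [lintegral_add_left' (hum.abs.pow_const p).ennreal_ofReal.restrict]
        exact ENNReal.add_lt_top.2 ⟨hup, hvp⟩)
      (lintegral_one_div_one_add_norm_rpow_lt_top (lt_add_of_pos_right _ (mul_pos hp0 hs)))
    have t2 := lintegral_prod_mul_div_lt_top hΩ hb hU hΩU (m := N + p * s) (by positivity)
      (a := fun x => 2 ^ (p - 1) * (1 + |v x| ^ p)) (h := fun y => |u y| ^ (p - 1))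
      (fun x => by positivity) (fun x => by positivity)
      (((aemeasurable_const (b := (1 : ℝ))).add (hvm.abs.pow_const p)).const_mul _).restrict
      (hum.abs.pow_const _)
      (by
        simp_rw [ENNReal.ofReal_mul (by positivity : (0 : ℝ) ≤ 2 ^ (p - 1))]
        rw [lintegral_const_mul' _ _ ENNReal.ofReal_ne_top]
        refine ENNReal.mul_lt_top ENNReal.ofReal_lt_top ?_
        refine lt_of_le_of_lt (lintegral_mono fun x => ENNReal.ofReal_add_le) ?_
        rw [lintegral_add_left' aemeasurable_const]
        exact ENNReal.add_lt_top.2 ⟨hΩfin, hvp⟩)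
      htail
    refine lt_of_le_of_lt (lintegral_mono_ae ?_)
      (lt_of_le_of_lt (lintegral_add_left' ?_ _).le (ENNReal.add_lt_top.2 ⟨t1, t2⟩))
    · filter_upwards [ae_prod_snd hUc] with z h2
      rw [← ENNReal.ofReal_add (by positivity) (by positivity), ← add_div, h2, sub_zero]
      refine ENNReal.ofReal_le_ofReal ?_
      gcongr
      have e1 := Real.abs_sub_rpow_le (a := u z.1) (b := u z.2) (r := p - 1) (by linarith)
      have e2 := Real.rpow_sub_one_mul_le (abs_nonneg (u z.1)) (abs_nonneg (v z.1)) hp1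
      have e3 := Real.rpow_le_one_add_rpow (abs_nonneg (v z.1)) zero_le_one hp1.le
      rw [Real.rpow_one] at e3
      have e4 : (0 : ℝ) ≤ 2 ^ (p - 1) := by positivity
      have e5 : 0 ≤ |u z.2| ^ (p - 1) := by positivity
      calc |u z.1 - u z.2| ^ (p - 1) * |v z.1|
          ≤ 2 ^ (p - 1) * (|u z.1| ^ (p - 1) + |u z.2| ^ (p - 1)) * |v z.1| := by gcongr
        _ = 2 ^ (p - 1) * (|u z.1| ^ (p - 1) * |v z.1| + |v z.1| * |u z.2| ^ (p - 1)) := by ring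
        _ ≤ 2 ^ (p - 1) * ((|u z.1| ^ p + |v z.1| ^ p)
            + (1 + |v z.1| ^ p) * |u z.2| ^ (p - 1)) := by gcongr
        _ = _ := by ring
    · have hm1 : AEMeasurable (fun x => 2 ^ (p - 1) * (|u x| ^ p + |v x| ^ p) * 1)
        (volume.restrict Ω) :=
        ((((hum.abs.pow_const p).add (hvm.abs.pow_const p)).const_mul _).mul_const _).restrict
      exact (hm1.comp_fst.div
        ((measurable_fst.sub measurable_snd).norm.pow_const _).aemeasurable).ennreal_ofReal

end Spaces

/-! ### Subcritical fractional Sobolev embedding -/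

section Sobolev

variable {N : ℕ} {s p : ℝ} {Ω U : Set (RN N)} {u : RN N → ℝ}

lemma Real.rpow_le_of_rpow_le_mul_rpow_div {t c A a b : ℝ} (ht : 0 ≤ t) (hc : 0 ≤ c) (hA : 0 ≤ A)
    (ha : 0 < a) (hb : 0 < b) (h : t ^ a ≤ c * A ^ (a / b)) : t ^ b ≤ c ^ (b / a) * A := by
  have h1 : (t ^ a) ^ (b / a) ≤ (c * A ^ (a / b)) ^ (b / a) :=
    Real.rpow_le_rpow (by positivity) h (by positivity)
  rw [← Real.rpow_mul ht, Real.mul_rpow hc (by positivity), ← Real.rpow_mul hA] at h1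
  have e1 : a * (b / a) = b := by field_simp
  have e2 : a / b * (b / a) = 1 := by field_simp
  rwa [e1, e2, Real.rpow_one] at h1

/-- A ball contains a point `y` at which both `|u x - u y|` and `|u y|` are controlled by averages;
choosing the radius `r₀ A^{-a/(bN)}` balances the two bounds. -/
lemma exists_abs_rpow_le_mul [NeZero N] (hp : 0 < p) (hs : 0 < s) {a b M r₀ : ℝ} (ha : 0 < a)
    (hb : b * N = p * (a * s + N)) (hM : 0 < M) (hr₀ : 0 < r₀) :
    ∃ C : ℝ, 0 < C ∧ ∀ (u : RN N → ℝ) (x : RN N) (A : ℝ), 1 ≤ A →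
      AEMeasurable u (volume.restrict (Metric.ball x r₀)) →
      ∫⁻ y in Metric.ball x r₀, ENNReal.ofReal (|u y| ^ a) ≤ ENNReal.ofReal M →
      ∫⁻ y in Metric.ball x r₀, ENNReal.ofReal (|u x - u y| ^ p / ‖x - y‖ ^ ((N : ℝ) + p * s))
        ≤ ENNReal.ofReal A →
      |u x| ^ b ≤ C * A := by
  have hN : (0 : ℝ) < N := by exact_mod_cast NeZero.pos N
  have hb0 : 0 < b := by
    have : 0 < b * N := by rw [hb]; positivity
    exact pos_of_mul_pos_left this hN.le
  set ω : ℝ := (volume (Metric.ball (0 : RN N) 1)).toReal with hω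
  have hω0 : 0 < ω := ENNReal.toReal_pos (Metric.measure_ball_pos _ _ one_pos).ne'
    measure_ball_lt_top.ne
  set c₁ : ℝ := 2 / ω * r₀ ^ (p * s) with hc₁
  set c₂ : ℝ := 2 / ω * M * r₀ ^ (-(N : ℝ)) with hc₂
  have hc₁0 : 0 < c₁ := by positivity
  have hc₂0 : 0 < c₂ := by positivity
  refine ⟨2 ^ b * (c₁ ^ (b / p) + c₂ ^ (b / a)), by positivity, fun u x A hA hu hint hG => ?_⟩
  have hA0 : 0 < A := by linarith
  set κ : ℝ := a / (b * N) with hκ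
  set r : ℝ := r₀ * A ^ (-κ) with hr
  have hr0 : 0 < r := by positivity
  have hrr : r ≤ r₀ := by
    have : A ^ (-κ) ≤ 1 := Real.rpow_le_one_of_one_le_of_nonpos hA (by
      rw [neg_nonpos]; positivity)
    calc r ≤ r₀ * 1 := mul_le_mul_of_nonneg_left this hr₀.le
      _ = r₀ := mul_one _
  have hball : Metric.ball x r ⊆ Metric.ball x r₀ := Metric.ball_subset_ball hrr
  have hu' : AEMeasurable u (volume.restrict (Metric.ball x r)) :=
    hu.mono_measure (Measure.restrict_mono hball le_rfl)
  set m : ℝ := N + p * s with hm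
  have hm0 : 0 < m := by positivity
  have hvol : volume (Metric.ball x r) = ENNReal.ofReal (r ^ N * ω) := by
    rw [Measure.addHaar_ball _ _ hr0.le, ENNReal.ofReal_mul (by positivity), hω,
      ENNReal.ofReal_toReal measure_ball_lt_top.ne]
    simp
  have hm1 : AEMeasurable (fun y => ENNReal.ofReal (|u x - u y| ^ p / (r ^ m * A)))
      (volume.restrict (Metric.ball x r)) :=
    (((aemeasurable_const.sub hu').abs.pow_const p).div_const _).ennreal_ofReal
  have hm2 : AEMeasurable (fun y => ENNReal.ofReal (|u y| ^ a / M))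
      (volume.restrict (Metric.ball x r)) :=
    ((hu'.abs.pow_const a).div_const _).ennreal_ofReal
  have hI1 : ∫⁻ y in Metric.ball x r, ENNReal.ofReal (|u x - u y| ^ p / (r ^ m * A)) ≤ 1 := by
    calc _ ≤ ∫⁻ y in Metric.ball x r, ENNReal.ofReal A⁻¹ *
          ENNReal.ofReal (|u x - u y| ^ p / ‖x - y‖ ^ m) := by
          refine setLIntegral_mono' measurableSet_ball fun y hy => ?_
          rw [← ENNReal.ofReal_mul (by positivity)]
          refine ENNReal.ofReal_le_ofReal ?_
          rcases eq_or_ne x y with rfl | hxy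
          · simp [Real.zero_rpow hp.ne']
          · have hpos : 0 < ‖x - y‖ := norm_pos_iff.2 (sub_ne_zero.2 hxy)
            have hle : ‖x - y‖ ≤ r := by
              rw [← dist_eq_norm, dist_comm]; exact (Metric.mem_ball.1 hy).le
            calc |u x - u y| ^ p / (r ^ m * A) = A⁻¹ * (|u x - u y| ^ p / r ^ m) := by
                  field_simp
              _ ≤ A⁻¹ * (|u x - u y| ^ p / ‖x - y‖ ^ m) := by gcongr
      _ = ENNReal.ofReal A⁻¹ * ∫⁻ y in Metric.ball x r,
          ENNReal.ofReal (|u x - u y| ^ p / ‖x - y‖ ^ m) :=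
          lintegral_const_mul' _ _ ENNReal.ofReal_ne_top
      _ ≤ ENNReal.ofReal A⁻¹ * ENNReal.ofReal A := by
          gcongr
          exact (lintegral_mono_set hball).trans hG
      _ = 1 := by rw [← ENNReal.ofReal_mul (by positivity), inv_mul_cancel₀ hA0.ne',
          ENNReal.ofReal_one]
  have hI2 : ∫⁻ y in Metric.ball x r, ENNReal.ofReal (|u y| ^ a / M) ≤ 1 := by
    calc _ = ∫⁻ y in Metric.ball x r, ENNReal.ofReal M⁻¹ * ENNReal.ofReal (|u y| ^ a) := by
          refine lintegral_congr fun y => ?_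
          rw [← ENNReal.ofReal_mul (by positivity), div_eq_inv_mul]
      _ = ENNReal.ofReal M⁻¹ * ∫⁻ y in Metric.ball x r, ENNReal.ofReal (|u y| ^ a) :=
          lintegral_const_mul' _ _ ENNReal.ofReal_ne_top
      _ ≤ ENNReal.ofReal M⁻¹ * ENNReal.ofReal M := by
          gcongr
          exact (lintegral_mono_set hball).trans hint
      _ = 1 := by rw [← ENNReal.ofReal_mul (by positivity), inv_mul_cancel₀ hM.ne',
          ENNReal.ofReal_one]
  obtain ⟨y, -, hy⟩ := exists_le_setLAverage (Metric.measure_ball_pos volume x hr0).ne'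
    measure_ball_lt_top.ne (hm1.add hm2)
  rw [setLAverage_eq] at hy
  simp only [Pi.add_apply] at hy
  rw [lintegral_add_left' hm1, hvol,
    ← ENNReal.ofReal_add (by positivity) (by positivity)] at hy
  have hy2 : ENNReal.ofReal (|u x - u y| ^ p / (r ^ m * A) + |u y| ^ a / M)
      ≤ ENNReal.ofReal (2 / (r ^ N * ω)) := by
    refine hy.trans ?_
    rw [ENNReal.ofReal_div_of_pos (by positivity)]
    gcongr
    calc _ ≤ (1 : ENNReal) + 1 := add_le_add hI1 hI2
      _ = ENNReal.ofReal 2 := by norm_num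
  rw [ENNReal.ofReal_le_ofReal_iff (by positivity)] at hy2
  have hX0 : 0 ≤ |u x - u y| ^ p / (r ^ m * A) := by positivity
  have hY0 : 0 ≤ |u y| ^ a / M := by positivity
  have hX : |u x - u y| ^ p / (r ^ m * A) ≤ 2 / (r ^ N * ω) := by linarith
  have hY : |u y| ^ a / M ≤ 2 / (r ^ N * ω) := by linarith
  have hrN : r ^ N = r ^ (N : ℝ) := (Real.rpow_natCast r N).symm
  rw [div_le_iff₀ (by positivity), hrN] at hX hY
  have hbN : b * N ≠ 0 := by positivity
  have hX' : |u x - u y| ^ p ≤ c₁ * A ^ (p / b) := by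
    refine hX.trans (le_of_eq ?_)
    have e : p / b = -κ * (p * s) + 1 := by
      rw [hκ]; field_simp; linear_combination -hb
    rw [hm, Real.rpow_add hr0, e, Real.rpow_add hA0, Real.rpow_one, Real.rpow_mul hA0.le, hc₁]
    have : r ^ (p * s) = r₀ ^ (p * s) * (A ^ (-κ)) ^ (p * s) :=
      Real.mul_rpow hr₀.le (by positivity)
    rw [this]
    have := (Real.rpow_pos_of_pos hr0 (N : ℝ)).ne'
    field_simp
  have hY' : |u y| ^ a ≤ c₂ * A ^ (a / b) := by
    refine hY.trans (le_of_eq ?_)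
    have e : a / b = -κ * -(N : ℝ) := by
      rw [hκ]; field_simp
    rw [e, Real.rpow_mul hA0.le, hc₂]
    have h1 : r ^ (-(N : ℝ)) = r₀ ^ (-(N : ℝ)) * (A ^ (-κ)) ^ (-(N : ℝ)) :=
      Real.mul_rpow hr₀.le (by positivity)
    rw [mul_assoc (2 / ω * M), ← h1, Real.rpow_neg hr0.le]
    have := (Real.rpow_pos_of_pos hr0 (N : ℝ)).ne'
    field_simp
  have f1 := Real.rpow_le_of_rpow_le_mul_rpow_div (abs_nonneg _) hc₁0.le hA0.le hp hb0 hX'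
  have f2 := Real.rpow_le_of_rpow_le_mul_rpow_div (abs_nonneg _) hc₂0.le hA0.le ha hb0 hY'
  have htri : |u x| ≤ |u x - u y| + |u y| := by
    simpa using abs_add_le (u x - u y) (u y)
  calc |u x| ^ b ≤ (|u x - u y| + |u y|) ^ b := Real.rpow_le_rpow (abs_nonneg _) htri hb0.le
    _ ≤ 2 ^ b * (|u x - u y| ^ b + |u y| ^ b) :=
        Real.add_rpow_le_two_rpow_mul (abs_nonneg _) (abs_nonneg _) hb0.le
    _ ≤ 2 ^ b * (c₁ ^ (b / p) * A + c₂ ^ (b / a) * A) := by gcongr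
    _ = _ := by ring

/-- `|u|^a` is integrable on every bounded open set lying well inside `U`. -/
def LocIntegrablePow (U : Set (RN N)) (u : RN N → ℝ) (a : ℝ) : Prop :=
  ∀ K : Set (RN N), IsOpen K → Bornology.IsBounded K →
    (∃ δ > 0, Metric.thickening δ K ⊆ U) → ∫⁻ x in K, ENNReal.ofReal (|u x| ^ a) < ⊤

/-- One step of the bootstrap `L^a → L^b`, `b = p + a p s / N`. -/
lemma LocIntegrablePow.step [NeZero N] (hp : 0 < p) (hs : 0 < s) (hu : MemW s p U u) {a b : ℝ}
    (ha : 0 < a) (hb : b * N = p * (a * s + N)) (h : LocIntegrablePow U u a) :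
    LocIntegrablePow U u b := by
  rintro K hK hKb ⟨δ, hδ, hδU⟩
  have hδ2 : 0 < δ / 2 := by positivity
  have hthick : Metric.thickening (δ / 2) (Metric.thickening (δ / 2) K) ⊆ U :=
    (Metric.thickening_thickening_subset _ _ _).trans (by rwa [add_halves])
  have hint := h (Metric.thickening (δ / 2) K) Metric.isOpen_thickening hKb.thickening
    ⟨δ / 2, hδ2, hthick⟩
  set I := ∫⁻ x in Metric.thickening (δ / 2) K, ENNReal.ofReal (|u x| ^ a) with hI
  obtain ⟨C, hC, hCb⟩ := exists_abs_rpow_le_mul (N := N) hp hs ha hb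
    (M := I.toReal + 1) (r₀ := δ / 2) (by positivity) hδ2
  set g : RN N → ENNReal := fun x =>
    ∫⁻ y in U, ENNReal.ofReal (|u x - u y| ^ p / ‖x - y‖ ^ ((N : ℝ) + p * s)) with hg
  have hmeas := aemeasurable_gagliardo_integrand hu.aemeasurable hu.aemeasurable p
    ((N : ℝ) + p * s)
  have hgm : AEMeasurable g (volume.restrict U) := hmeas.lintegral_prod_right'
  have hgi : ∫⁻ x in U, g x < ⊤ := by
    have := hu.2
    rwa [gagliardo, lintegral_prod _ hmeas] at this
  have hKU : K ⊆ U := (Metric.self_subset_thickening hδ K).trans hδU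
  have hgK : ∫⁻ x in K, g x < ⊤ := (lintegral_mono_set hKU).trans_lt hgi
  have hgmK : AEMeasurable g (volume.restrict K) :=
    hgm.mono_measure (Measure.restrict_mono hKU le_rfl)
  calc ∫⁻ x in K, ENNReal.ofReal (|u x| ^ b)
      ≤ ∫⁻ x in K, ENNReal.ofReal C * (1 + g x) := by
        refine lintegral_mono_ae ?_
        filter_upwards [ae_restrict_mem hK.measurableSet, ae_lt_top' hgmK hgK.ne] with x hx hgx
        have hbK : Metric.ball x (δ / 2) ⊆ Metric.thickening (δ / 2) K :=
          Metric.ball_subset_thickening hx _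
        have hbU : Metric.ball x (δ / 2) ⊆ U :=
          hbK.trans ((Metric.self_subset_thickening hδ2 _).trans hthick)
        have := hCb u x (1 + (g x).toReal) (by linarith [ENNReal.toReal_nonneg (a := g x)])
          (hu.aemeasurable.mono_measure (Measure.restrict_mono hbU le_rfl))
          ((lintegral_mono_set hbK).trans (by
            rw [← hI]
            refine (ENNReal.ofReal_toReal hint.ne).symm.le.trans ?_
            exact ENNReal.ofReal_le_ofReal (by linarith)))
          ((lintegral_mono_set hbU).trans (by
            refine (ENNReal.ofReal_toReal hgx.ne).symm.le.trans ?_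
            exact ENNReal.ofReal_le_ofReal (by simp only [hg]; linarith)))
        refine (ENNReal.ofReal_le_ofReal this).trans ?_
        rw [ENNReal.ofReal_mul hC.le, ENNReal.ofReal_add zero_le_one ENNReal.toReal_nonneg,
          ENNReal.ofReal_one, ENNReal.ofReal_toReal hgx.ne]
    _ = ENNReal.ofReal C * (volume K + ∫⁻ x in K, g x) := by
        rw [lintegral_const_mul' _ _ ENNReal.ofReal_ne_top, lintegral_add_left' aemeasurable_const]
        simp
    _ < ⊤ := ENNReal.mul_lt_top ENNReal.ofReal_lt_top
        (ENNReal.add_lt_top.2 ⟨hKb.measure_lt_top, hgK⟩)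

/-- `W^{s,p}(U)` embeds into `L^q(Ω)` for `q` below the critical exponent and bounded `Ω ⋐ U`. -/
lemma MemW.lintegral_rpow_lt_top [NeZero N] (hp : 0 < p) (hs : 0 < s) (hps : p * s < N)
    (hΩ : IsOpen Ω) (hb : Bornology.IsBounded Ω) (hU : IsOpen U) (hΩU : closure Ω ⊆ U)
    (hu : MemW s p U u) {q : ℝ} (hq0 : 0 ≤ q) (hq : q < N * p / (N - p * s)) :
    ∫⁻ x in Ω, ENNReal.ofReal (|u x| ^ q) < ⊤ := by
  have hN : (0 : ℝ) < N := by exact_mod_cast NeZero.pos N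
  obtain ⟨δ, hδ, hδU⟩ := hb.isCompact_closure.exists_thickening_subset_open hU hΩU
  have hd : (0 : ℝ) < N - p * s := by linarith
  set P : ℝ := N * p / (N - p * s) with hP
  set θ : ℝ := p * s / N with hθ
  have hθ0 : 0 < θ := by positivity
  have hθ1 : θ < 1 := (div_lt_one hN).2 hps
  have hpP : p < P := by
    rw [hP, lt_div_iff₀ hd]
    nlinarith [mul_pos hp hs]
  have hPfix : P * N = p * (P * s + N) := by
    rw [hP]; field_simp; ring
  -- The exponents `P - θ^n (P - p)` start at `p` and increase to the critical one, `P`.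
  have hiter : ∀ n : ℕ, LocIntegrablePow U u (P - θ ^ n * (P - p)) := by
    intro n
    induction n with
    | zero =>
      rintro K hK hKb ⟨ε, hε, hεU⟩
      have : P - θ ^ 0 * (P - p) = p := by ring
      rw [this]
      exact (lintegral_mono_set ((Metric.self_subset_thickening hε K).trans hεU)).trans_lt
        ((memLp_ofReal_iff hp).1 hu.1).2
    | succ n ih =>
      refine ih.step hp hs hu ?_ ?_
      · nlinarith [pow_le_one₀ hθ0.le hθ1.le (n := n)]
      · have e : θ * N = p * s := by rw [hθ]; field_simp
        rw [pow_succ]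
        linear_combination hPfix - θ ^ n * (P - p) * e
  have hlim : Filter.Tendsto (fun n : ℕ => P - θ ^ n * (P - p)) Filter.atTop (nhds P) := by
    simpa using tendsto_const_nhds.sub
      ((tendsto_pow_atTop_nhds_zero_of_lt_one hθ0.le hθ1).mul_const (P - p))
  obtain ⟨n, hn⟩ := (hlim.eventually_const_lt hq).exists
  have hfin := hiter n Ω hΩ hb
    ⟨δ, hδ, (Metric.thickening_subset_of_subset δ subset_closure).trans hδU⟩
  refine lt_of_le_of_lt (lintegral_mono fun x => ?_)
    (lt_of_le_of_lt (lintegral_add_left' (aemeasurable_const (b := (1 : ENNReal))) _).le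
      (ENNReal.add_lt_top.2 ⟨?_, hfin⟩))
  · rw [← ENNReal.ofReal_one, ← ENNReal.ofReal_add zero_le_one (by positivity)]
    exact ENNReal.ofReal_le_ofReal (Real.rpow_le_one_add_rpow (abs_nonneg _) hq0 hn.le)
  · simpa using hb.measure_lt_top

end Sobolev

/-! ### Lattice operations on supersolutions and subsolutions -/

section Lattice

variable {N : ℕ} {s p : ℝ} {Ω : Set (RN N)} {f : RN N → ℝ → ℝ} {u u₁ u₂ v : RN N → ℝ}

/-- The reaction term is integrable against `W^{s,p}_0(Ω)`: this uses subcriticality. -/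
lemma HypH0.integrableOn_mul [NeZero N] (hf : HypH0 s p Ω f) (hp : 2 ≤ p) (hs : 0 < s)
    (hps : p * s < N) (hΩ : IsOpen Ω) (hb : Bornology.IsBounded Ω) (hu : MemWTilde s p Ω u)
    (hv : MemW0 s p Ω v) : IntegrableOn (fun x => f x (u x) * v x) Ω := by
  obtain ⟨hcar, c₀, q, hc₀, hpq, hqP, hgrowth⟩ := hf
  have hp0 : 0 < p := by linarith
  have hum : AEMeasurable u (volume.restrict Ω) := hu.aestronglyMeasurable.aemeasurable.restrict
  have hvm : AEMeasurable v (volume.restrict Ω) := hv.aestronglyMeasurable.aemeasurable.restrict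
  obtain ⟨-, ⟨U, hU, hΩU, hWU⟩, -⟩ := hu
  have hq1 : 1 < q := by linarith
  have hqu := hWU.lintegral_rpow_lt_top hp0 hs hps hΩ hb hU hΩU (by linarith : 0 ≤ q) hqP
  have hqv := hv.1.lintegral_rpow_lt_top hp0 hs hps hΩ hb isOpen_univ (subset_univ _)
    (by linarith : 0 ≤ q) hqP
  have hint : ∀ {w : RN N → ℝ}, AEMeasurable w (volume.restrict Ω) →
      ∫⁻ x in Ω, ENNReal.ofReal (|w x| ^ q) < ⊤ → IntegrableOn (fun x => |w x| ^ q) Ω :=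
    fun hw hi => ⟨(hw.abs.pow_const q).aestronglyMeasurable,
      (hasFiniteIntegral_iff_ofReal (Filter.Eventually.of_forall fun x => by positivity)).2 hi⟩
  have hone : IntegrableOn (fun _ : RN N => (1 : ℝ)) Ω := integrableOn_const hb.measure_lt_top.ne
  have hdom := ((hone.add (hint hum hqu)).add ((hint hvm hqv).const_mul 2)).const_mul c₀
  refine Integrable.mono' hdom ((hcar.aemeasurable_comp hum).mul hvm).aestronglyMeasurable ?_
  filter_upwards [hgrowth] with x hx
  rw [Real.norm_eq_abs, abs_mul]
  have e1 := Real.rpow_sub_one_mul_le (abs_nonneg (u x)) (abs_nonneg (v x)) hq1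
  have e2 := Real.rpow_le_one_add_rpow (abs_nonneg (v x)) zero_le_one hq1.le
  rw [Real.rpow_one] at e2
  calc |f x (u x)| * |v x| ≤ c₀ * (1 + |u x| ^ (q - 1)) * |v x| := by
        gcongr; exact hx _
    _ = c₀ * (|v x| + |u x| ^ (q - 1) * |v x|) := by ring
    _ ≤ c₀ * ((1 + |v x| ^ q) + (|u x| ^ q + |v x| ^ q)) := by gcongr
    _ = _ := by simp only [Pi.add_apply]; ring

lemma MemWTilde.min (hp : 2 ≤ p) (h₁ : MemWTilde s p Ω u₁) (h₂ : MemWTilde s p Ω u₂) :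
    MemWTilde s p Ω (fun x => min (u₁ x) (u₂ x)) := by
  have hm₁ := h₁.aestronglyMeasurable
  have hm₂ := h₂.aestronglyMeasurable
  obtain ⟨hloc₁, ⟨U₁, hU₁, hΩU₁, hW₁⟩, ht₁⟩ := h₁
  obtain ⟨hloc₂, ⟨U₂, hU₂, hΩU₂, hW₂⟩, ht₂⟩ := h₂
  refine ⟨fun K hK => (hloc₁ K hK).inf (hloc₂ K hK),
    ⟨U₁ ∩ U₂, hU₁.inter hU₂, subset_inter hΩU₁ hΩU₂, ?_⟩, ?_⟩
  · exact MemW.of_abs_le_max (by linarith) (hW₁.mono inter_subset_left)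
      (hW₂.mono inter_subset_right) (hm₁.inf hm₂).restrict (fun x => abs_min_le_max_abs_abs)
      (fun x y => abs_min_sub_min_le_max _ _ _ _)
  · have hmeas : AEMeasurable (fun x : RN N =>
        ENNReal.ofReal (|u₁ x| ^ (p - 1) / (1 + ‖x‖) ^ ((N : ℝ) + p * s))) :=
      ((hm₁.aemeasurable.abs.pow_const _).div
        ((measurable_const.add measurable_norm).pow_const _).aemeasurable).ennreal_ofReal
    refine lt_of_le_of_lt (lintegral_mono fun x => ?_)
      (lt_of_le_of_lt (lintegral_add_left' hmeas _).le (ENNReal.add_lt_top.2 ⟨ht₁, ht₂⟩))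
    rw [← ENNReal.ofReal_add (by positivity) (by positivity), ← add_div]
    refine ENNReal.ofReal_le_ofReal ?_
    gcongr
    exact Real.rpow_le_rpow_add_rpow_of_le_max (by linarith) (abs_nonneg _) (abs_nonneg _)
      (abs_nonneg _) abs_min_le_max_abs_abs

/-- The truncations `min v (k (u₁ - u₂)⁺)` are admissible test functions. -/
lemma MemW0.min_mul_max_sub (hp : 0 < p) (hs : 0 < s) (hΩ : IsOpen Ω)
    (hb : Bornology.IsBounded Ω) (h₁ : MemWTilde s p Ω u₁) (h₂ : MemWTilde s p Ω u₂)
    (hv : MemW0 s p Ω v) {k : ℝ} (hk : 0 ≤ k) :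
    MemW0 s p Ω (fun x => min (v x) (k * max (u₁ x - u₂ x) 0)) := by
  have hm₁ := h₁.aestronglyMeasurable
  have hm₂ := h₂.aestronglyMeasurable
  obtain ⟨-, ⟨U₁, hU₁, hΩU₁, hW₁⟩, -⟩ := h₁
  obtain ⟨-, ⟨U₂, hU₂, hΩU₂, hW₂⟩, -⟩ := h₂
  have hmax : AEStronglyMeasurable (fun x => max (u₁ x - u₂ x) 0) :=
    (hm₁.sub hm₂).sup aestronglyMeasurable_const
  have hmin : AEStronglyMeasurable (fun x => min (v x) (k * max (u₁ x - u₂ x) 0)) :=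
    hv.aestronglyMeasurable.inf (hmax.const_mul k)
  have hd : MemW s p (U₁ ∩ U₂) (fun x => u₁ x - u₂ x) :=
    (hW₁.mono inter_subset_left).sub hp (hW₂.mono inter_subset_right)
  have hd' : MemW s p (U₁ ∩ U₂) (fun x => max (u₁ x - u₂ x) 0) := by
    refine MemW.of_abs_le_max hp hd hd hmax.restrict (fun x => ?_) (fun x y => ?_)
    · simpa using abs_max_le_max_abs_abs (a := u₁ x - u₂ x) (b := 0)
    · simpa using abs_max_sub_max_le_abs (u₁ x - u₂ x) (u₁ y - u₂ y) 0
  refine MemW.memW0 hp hs hΩ hb (hU₁.inter hU₂) (subset_inter hΩU₁ hΩU₂) hmin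
    (MemW.of_abs_le_max hp (hv.memW _) (hd'.const_mul k) hmin.restrict
      (fun x => abs_min_le_max_abs_abs) (fun x y => abs_min_sub_min_le_max _ _ _ _)) ?_
  filter_upwards [hv.2] with x hx
  rw [hx, min_eq_left (mul_nonneg hk (le_max_right _ _))]

lemma MemW0.sub (hp : 0 < p) {w : RN N → ℝ} (hv : MemW0 s p Ω v) (hw : MemW0 s p Ω w) :
    MemW0 s p Ω (fun x => v x - w x) := by
  refine ⟨hv.1.sub hp hw.1, ?_⟩
  filter_upwards [hv.2, hw.2] with x h1 h2
  rw [h1, h2, sub_zero]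

/-- The minimum of two supersolutions is a supersolution: `u₂` is tested with
`min v (n (u₁ - u₂)⁺)`, `u₁` with the remaining part of `v`, and `n → ∞`. -/
lemma IsSupersolution.min [NeZero N] (hf : HypH0 s p Ω f) (hp : 2 ≤ p) (hs : 0 < s)
    (hps : p * s < N) (hΩ : IsOpen Ω) (hb : Bornology.IsBounded Ω)
    (h₁ : IsSupersolution s p Ω f u₁) (h₂ : IsSupersolution s p Ω f u₂) :
    IsSupersolution s p Ω f (fun x => min (u₁ x) (u₂ x)) := by
  have hmem := h₁.mem.min hp h₂.mem
  have hp0 : 0 < p := by linarith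
  have hp1 : 1 < p := by linarith
  refine ⟨hmem, ?_, fun v hv hv0 => ?_⟩
  · filter_upwards [h₁.nonneg_compl, h₂.nonneg_compl] with x hx₁ hx₂ using le_min hx₁ hx₂
  set φ : ℕ → RN N → ℝ := fun n x => Min.min (v x) (n * max (u₁ x - u₂ x) 0) with hφ
  have hφW : ∀ n, MemW0 s p Ω (φ n) := fun n =>
    hv.min_mul_max_sub hp0 hs hΩ hb h₁.mem h₂.mem n.cast_nonneg
  have hψW : ∀ n, MemW0 s p Ω (fun x => v x - φ n x) := fun n => hv.sub hp0 (hφW n)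
  have hφ0 : ∀ n, ∀ᵐ x, 0 ≤ φ n x := fun n => by
    filter_upwards [hv0] with x hx
    exact le_min hx (mul_nonneg n.cast_nonneg (le_max_right _ _))
  have hψ0 : ∀ n, ∀ᵐ x, 0 ≤ v x - φ n x := fun n =>
    Filter.Eventually.of_forall fun x => sub_nonneg.2 (min_le_left _ _)
  have hφlim : ∀ᵐ x, ∀ᶠ n in Filter.atTop, φ n x = if 0 < u₁ x - u₂ x then v x else 0 := by
    filter_upwards [hv0] with x hx using eventually_min_nat_mul_eq hx
  -- The reaction terms converge by dominated convergence.
  have hi₁ := fun w (hw : MemW0 s p Ω w) => hf.integrableOn_mul hp hs hps hΩ hb h₁.mem hw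
  have hi₂ := fun w (hw : MemW0 s p Ω w) => hf.integrableOn_mul hp hs hps hΩ hb h₂.mem hw
  have hR : Filter.Tendsto (fun n => ∫ x in Ω,
      (f x (u₁ x) * (v x - φ n x) + f x (u₂ x) * φ n x)) Filter.atTop
      (nhds (∫ x in Ω, f x (Min.min (u₁ x) (u₂ x)) * v x)) := by
    refine tendsto_integral_of_dominated_convergence
      (fun x => |f x (u₁ x) * v x| + |f x (u₂ x) * v x|)
      (fun n => ((hi₁ _ (hψW n)).add (hi₂ _ (hφW n))).aestronglyMeasurable)
      ((hi₁ v hv).abs.add (hi₂ v hv).abs) (fun n => ?_) ?_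
    · filter_upwards [ae_restrict_of_ae hv0, ae_restrict_of_ae (hφ0 n)] with x hx hx2
      have hle : φ n x ≤ v x := min_le_left _ _
      rw [Real.norm_eq_abs]
      refine (abs_add_le _ _).trans ?_
      rw [abs_mul, abs_mul, abs_mul, abs_mul]
      refine add_le_add (mul_le_mul_of_nonneg_left ?_ (abs_nonneg _))
        (mul_le_mul_of_nonneg_left ?_ (abs_nonneg _))
      · rw [abs_of_nonneg (sub_nonneg.2 hle), abs_of_nonneg hx]; linarith
      · rwa [abs_of_nonneg hx2, abs_of_nonneg hx]
    · filter_upwards [ae_restrict_of_ae hφlim] with x hx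
      refine tendsto_const_nhds.congr' ?_
      filter_upwards [hx] with n hn
      rw [hn]
      by_cases hd : 0 < u₁ x - u₂ x
      · rw [if_pos hd, min_eq_right (by linarith : u₂ x ≤ u₁ x)]; ring
      · rw [if_neg hd, min_eq_left (by linarith : u₁ x ≤ u₂ x)]; ring
  -- The pairings are bounded above by integrals converging to the pairing of the minimum.
  set K : RN N × RN N → ℝ := fun z => ‖z.1 - z.2‖ ^ ((N : ℝ) + p * s) with hK
  have hK0 : ∀ z, 0 ≤ K z := fun z => Real.rpow_nonneg (norm_nonneg _) _
  have hj₁ := fun w (hw : MemW0 s p Ω w) => h₁.mem.integrable_pairing hp hs hΩ hb hw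
  have hj₂ := fun w (hw : MemW0 s p Ω w) => h₂.mem.integrable_pairing hp hs hΩ hb hw
  have hj := hmem.integrable_pairing hp hs hΩ hb hv
  set J : RN N × RN N → ℝ := fun z =>
    signedPow p (Min.min (u₁ z.1) (u₂ z.1) - Min.min (u₁ z.2) (u₂ z.2)) * (v z.1 - v z.2) / K z
    with hJ
  set I : ℕ → RN N × RN N → ℝ := fun n z =>
    signedPow p (u₁ z.1 - u₁ z.2) * ((v z.1 - φ n z.1) - (v z.2 - φ n z.2)) / K z
      + signedPow p (u₂ z.1 - u₂ z.2) * (φ n z.1 - φ n z.2) / K z with hI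
  have hIi : ∀ n, Integrable (I n) := fun n => (hj₁ _ (hψW n)).add (hj₂ _ (hφW n))
  set H : RN N × RN N → ℝ := fun z =>
    2 * |signedPow p (u₁ z.1 - u₁ z.2) * (v z.1 - v z.2) / K z|
      + |signedPow p (u₂ z.1 - u₂ z.2) * (v z.1 - v z.2) / K z| with hH
  have hHi : Integrable H := ((hj₁ v hv).abs.const_mul 2).add (hj₂ v hv).abs
  have hIH : ∀ n z, I n z ≤ H z := fun n z => by
    simp only [hI, hH]
    rw [abs_div, abs_div, abs_mul, abs_mul, abs_of_nonneg (hK0 z), ← mul_div_assoc, ← add_div,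
      ← add_div]
    refine div_le_div_of_nonneg_right ?_ (hK0 z)
    refine (signedPow_test_le hp1 n.cast_nonneg).trans (le_of_eq ?_)
    ring
  have hL : Filter.Tendsto (fun n => ∫ z, max (I n z) (J z)) Filter.atTop (nhds (∫ z, J z)) := by
    refine tendsto_integral_of_dominated_convergence (fun z => H z + |J z|)
      (fun n => ((hIi n).sup hj).aestronglyMeasurable) (hHi.add hj.abs) (fun n => ?_) ?_
    · refine Filter.Eventually.of_forall fun z => ?_
      have hH0 : 0 ≤ H z := by simp only [hH]; positivity
      rw [Real.norm_eq_abs, abs_le]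
      exact ⟨by linarith [neg_abs_le (J z), le_max_right (I n z) (J z)],
        max_le (by linarith [hIH n z, abs_nonneg (J z)]) (by linarith [le_abs_self (J z)])⟩
    · filter_upwards [ae_prod_fst hv0, ae_prod_snd hv0, ae_prod_fst hφlim, ae_prod_snd hφlim]
        with z hv1 hv2 hl1 hl2
      refine tendsto_const_nhds.congr' ?_
      filter_upwards [hl1, hl2] with n hn1 hn2
      refine (max_eq_right ?_).symm
      simp only [hI, hJ, hn1, hn2]
      rw [← add_div]
      exact div_le_div_of_nonneg_right (signedPow_limit_le hp1 hv1 hv2) (hK0 z)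
  refine le_of_tendsto_of_tendsto' hR hL fun n => ?_
  calc ∫ x in Ω, (f x (u₁ x) * (v x - φ n x) + f x (u₂ x) * φ n x)
      = (∫ x in Ω, f x (u₁ x) * (v x - φ n x)) + ∫ x in Ω, f x (u₂ x) * φ n x :=
        integral_add (hi₁ _ (hψW n)) (hi₂ _ (hφW n))
    _ ≤ fracPLaplacian s p u₁ (fun x => v x - φ n x) + fracPLaplacian s p u₂ (φ n) :=
        add_le_add (h₁.ge _ (hψW n) (hψ0 n)) (h₂.ge _ (hφW n) (hφ0 n))
    _ = ∫ z, I n z := (integral_add (hj₁ _ (hψW n)) (hj₂ _ (hφW n))).symm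
    _ ≤ ∫ z, max (I n z) (J z) :=
        integral_mono (hIi n) ((hIi n).sup hj) fun z => le_max_left _ _

lemma fracPLaplacian_neg (s p : ℝ) (u v : RN N → ℝ) :
    fracPLaplacian s p (fun x => -u x) v = -fracPLaplacian s p u v := by
  rw [fracPLaplacian, fracPLaplacian, ← integral_neg]
  refine integral_congr_ae (Filter.Eventually.of_forall fun z => ?_)
  simp only
  rw [neg_sub_neg, ← neg_sub (u z.1), abs_neg]
  ring

lemma MemWTilde.neg (h : MemWTilde s p Ω u) : MemWTilde s p Ω (fun x => -u x) := by
  obtain ⟨hloc, ⟨U, hU, hΩU, hW⟩, ht⟩ := h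
  refine ⟨fun K hK => (hloc K hK).neg, ⟨U, hU, hΩU, ?_⟩, by simpa using ht⟩
  simpa using hW.const_mul (-1)

/-- The reflection `u ↦ -u` exchanges subsolutions for `f` and supersolutions for
`(x, t) ↦ -f x (-t)`. -/
lemma isSupersolution_neg_iff :
    IsSupersolution s p Ω (fun x t => -f x (-t)) (fun x => -u x) ↔ IsSubsolution s p Ω f u := by
  constructor
  · intro h
    refine ⟨by simpa using h.mem.neg, ?_, fun v hv hv0 => ?_⟩
    · filter_upwards [h.nonneg_compl] with x hx using neg_nonneg.1 hx
    · have := h.ge v hv hv0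
      simp only [neg_neg, neg_mul, fracPLaplacian_neg, integral_neg] at this
      exact neg_le_neg_iff.1 this
  · intro h
    refine ⟨h.mem.neg, ?_, fun v hv hv0 => ?_⟩
    · filter_upwards [h.nonpos_compl] with x hx using neg_nonneg.2 hx
    · simp only [neg_neg, neg_mul, fracPLaplacian_neg, integral_neg]
      exact neg_le_neg (h.le v hv hv0)

lemma HypH0.neg (hf : HypH0 s p Ω f) : HypH0 s p Ω (fun x t => -f x (-t)) := by
  obtain ⟨⟨hm, hc⟩, c₀, q, hc₀, hpq, hq, hg⟩ := hf
  refine ⟨⟨fun t => (hm (-t)).neg, ?_⟩, c₀, q, hc₀, hpq, hq, ?_⟩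
  · filter_upwards [hc] with x hx using (hx.comp continuous_neg).neg
  · filter_upwards [hg] with x hx t
    simpa using hx (-t)

lemma IsSubsolution.max [NeZero N] (hf : HypH0 s p Ω f) (hp : 2 ≤ p) (hs : 0 < s)
    (hps : p * s < N) (hΩ : IsOpen Ω) (hb : Bornology.IsBounded Ω)
    (h₁ : IsSubsolution s p Ω f u₁) (h₂ : IsSubsolution s p Ω f u₂) :
    IsSubsolution s p Ω f (fun x => max (u₁ x) (u₂ x)) := by
  rw [← isSupersolution_neg_iff] at h₁ h₂ ⊢
  simpa only [min_neg_neg] using h₁.min hf.neg hp hs hps hΩ hb h₂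

end Lattice

theorem lemma3p1 (N : ℕ) (hN : 1 < N) (s p : ℝ) (hs0 : 0 < s) (hs1 : s < 1) (hp : 2 ≤ p)
    (hps : p * s < (N : ℝ)) (Ω : Set (RN N)) (hΩ : IsBoundedC11Domain Ω)
    (f : RN N → ℝ → ℝ) (hf : HypH0 s p Ω f) (u₁ u₂ : RN N → ℝ) :
    (IsSupersolution s p Ω f u₁ → IsSupersolution s p Ω f u₂ →
      IsSupersolution s p Ω f (fun x => min (u₁ x) (u₂ x))) ∧
    (IsSubsolution s p Ω f u₁ → IsSubsolution s p Ω f u₂ →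
      IsSubsolution s p Ω f (fun x => max (u₁ x) (u₂ x))) := by
  have : NeZero N := ⟨by omega⟩
  exact ⟨fun h₁ h₂ => h₁.min hf hp hs0 hps hΩ.isOpen hΩ.isBounded h₂,
    fun h₁ h₂ => h₁.max hf hp hs0 hps hΩ.isOpen hΩ.isBounded h₂⟩
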